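/- **Setting.** Let $(X,\mathscr B,\nu)$ be a $\sigma$-finite measure space, $\mathscr B_{fin}=\{A\in\mathscr B:\nu(A)<\infty\}$, and let $\mathscr D_{fin}\subset L^2(\nu)$ be the linear span of the indicators $\chi_A$, $A\in\mathscr B_{fin}$ (all spaces are real). Let $S$ be a closed (for instance selfadjoint) linear operator in $L^2(\nu)$ for which $\mathscr D_{fin}$ is a core, and let $k_A=S\chi_A$ and $K(A,B)=\langle k_A,k_B\rangle_{L^2(\nu)}$ for $A,B\in\mathscr B_{fin}$. Let $(W_A)_{A\in\mathscr B_{fin}}$ be a centered real Gaussian process on a probability space $(\Omega,\mathbb P)$ with $\mathbb E(W_AW_B)=K(A,B)$ for all $A,B\in\mathscr B_{fin}$. *Itô integral.* For $\psi=\sum_i\alpha_i\chi_{A_i}\in\mathscr D_{fin}$ put $\int\psi\,dW=\sum_i\alpha_iW_{A_i}$. For a measurable $\varphi:X\to\mathbb R$, the Itô integral $\int\varphi\,dW$ exists in $L^2(\mathbb P)$ if there are $\varphi_n\in\mathscr D_{fin}$ with $\varphi_n\to\varphi$ in $L^2(\nu)$ such that $\int\varphi_n\,dW$ converges in $L^2(\mathbb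 P)$; the limit (which does not depend on the choice of $\varphi_n$) is then $\int\varphi\,dW$. If the Itô integral does not exist, one puts $\mathbb E(|\int\varphi\,dW|^2)=\infty$. *Partitions.* Let $\mathscr A$ range over the countable partitions of $X$ into sets of $\mathscr B_{fin}$; write $\mathscr A\le\mathscr A'$ if $\mathscr A'$ refines $\mathscr A$, and let $\mathscr C_{\mathscr A}$ be the $\sigma$-algebra generated by $\{W_A: A\in\mathscr A\}$. The symbol $\mathbb E(|\int\varphi\,dW|^2\mid\mathscr C_{\mathscr A})\in[0,\infty]$ denotes the second moment of the projection of $\int\varphi\,dW$ to the $\mathscr C_{\mathscr A}$-measurable functions in $L^2(\mathbb P)$, $$\mathbb E\Big(\Big|\int\varphi\,dW\Big|^2\;\Big|\;\mathscr C_{\mathscr A}\Big):=\mathbb E\Big(\Big|\mathbb E\Big(\int\varphi\,dW\;\Big|\;\mathscr C_{\mathscr A}\Big)\Big|^2\Big)$$ if the Itô integral exists, where the inner symbol on the right is the usual conditional expectation, and $\infty$ otherwise. **Corollary 5.2 (Monotonicity).** For every measurable $\varphi:X\to\mathbb R$: 1. if $\mathscr A\le\mathscr A'$, then $\mathbb E(|\int\varphi\,dW|^2\mid\mathscr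 C_{\mathscr A})\le\mathbb E(|\int\varphi\,dW|^2\mid\mathscr C_{\mathscr A'})$; 2. $\sup_{\mathscr A}\mathbb E(|\int\varphi\,dW|^2\mid\mathscr C_{\mathscr A})=\mathbb E(|\int\varphi\,dW|^2)$; 3. this supremum over all partitions is finite if and only if $\varphi\in\mathrm{dom}(S)$ (that is, the class of $\varphi$ is an element of $L^2(\nu)$ lying in $\mathrm{dom}(S)$). -/

import Mathlib

open MeasureTheory ProbabilityTheory
open scoped ENNReal InnerProductSpace

namespace GaussianField

noncomputable section

/-- The family `𝓑_fin` of measurable sets of finite measure. -/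
abbrev Bfin {X : Type*} [MeasurableSpace X] (ν : Measure X) : Type _ :=
  {A : Set X // MeasurableSet A ∧ ν A < ∞}

/-- The indicator function of `A ∈ 𝓑_fin`, as an element of `L²(ν)`. -/
def chi {X : Type*} [MeasurableSpace X] (ν : Measure X) (A : Bfin ν) : Lp ℝ 2 ν :=
  indicatorConstLp 2 A.2.1 A.2.2.ne (1 : ℝ)

/-- `𝓓_fin`: the finite linear combinations of indicators of sets in `𝓑_fin`. -/
def Dfin {X : Type*} [MeasurableSpace X] (ν : Measure X) : Submodule ℝ (Lp ℝ 2 ν) :=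
  Submodule.span ℝ (Set.range (chi ν))

/-- The function `φ` represents an element of the domain of the operator `S` in `L²(ν)`. -/
def InDomain {X : Type*} [MeasurableSpace X] {ν : Measure X}
    (S : Lp ℝ 2 ν →ₗ.[ℝ] Lp ℝ 2 ν) (φ : X → ℝ) : Prop :=
  ∃ f ∈ S.domain, f =ᵐ[ν] φ

/-- A countable partition of `X` into (nonempty) sets from `𝓑_fin`. -/
structure CountablePartition {X : Type*} [MeasurableSpace X] (ν : Measure X) where
  parts : Set (Set X)
  countable : parts.Countable
  isPartition : Setoid.IsPartition parts
  mem_Bfin : ∀ A ∈ parts, MeasurableSet A ∧ ν A < ∞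

/-- `𝒜.RefinedBy 𝒜'` is the ordering `𝒜 ≤ 𝒜'`: the partition `𝒜'` is a refinement of `𝒜`. -/
def CountablePartition.RefinedBy {X : Type*} [MeasurableSpace X] {ν : Measure X}
    (𝒜 𝒜' : CountablePartition ν) : Prop :=
  ∀ A' ∈ 𝒜'.parts, ∃ A ∈ 𝒜.parts, A' ⊆ A

/-- `𝓒_𝒜`: the sigma-algebra generated by the variables `W_A`, `A ∈ 𝒜`. -/
@[reducible] def cylinderAlgebra {X Ω : Type*} [MeasurableSpace X] {ν : Measure X}
    (W : Bfin ν → Ω → ℝ) (𝒜 : CountablePartition ν) : MeasurableSpace Ω :=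
  ⨆ A : {A : Bfin ν // A.1 ∈ 𝒜.parts}, MeasurableSpace.comap (W A.1) inferInstance

/-- The graph of the elementary integral `∑ αᵢ χ_{Aᵢ} ↦ ∑ αᵢ W_{Aᵢ}`, inside `L²(ν) × L²(P)`. -/
def elementaryGraph {X Ω : Type*} [MeasurableSpace X] [MeasurableSpace Ω] {ν : Measure X}
    (P : Measure Ω) (W : Bfin ν → Ω → ℝ) : Submodule ℝ (Lp ℝ 2 ν × Lp ℝ 2 P) :=
  Submodule.span ℝ {p | ∃ A : Bfin ν, p.1 = chi ν A ∧ p.2 =ᵐ[P] W A}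

/-- `F ∈ L²(P)` is an Itô integral of `φ`: there are simple functions `φₙ ∈ 𝓓_fin` such that
`φₙ → φ` in `L²(ν)` and `∫ φₙ dW → F` in `L²(P)`. -/
def IsItoIntegral {X Ω : Type*} [MeasurableSpace X] [MeasurableSpace Ω] {ν : Measure X}
    (P : Measure Ω) (W : Bfin ν → Ω → ℝ) (φ : X → ℝ) (F : Lp ℝ 2 P) : Prop :=
  ∃ f : Lp ℝ 2 ν, f =ᵐ[ν] φ ∧ (f, F) ∈ (elementaryGraph P W).topologicalClosure

/-- The Itô integral `∫ φ dW` exists in `L²(P)`. -/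
def ItoIntegrable {X Ω : Type*} [MeasurableSpace X] [MeasurableSpace Ω] {ν : Measure X}
    (P : Measure Ω) (W : Bfin ν → Ω → ℝ) (φ : X → ℝ) : Prop :=
  ∃ F : Lp ℝ 2 P, IsItoIntegral P W φ F

open Classical in
/-- The Itô integral `∫ φ dW ∈ L²(P)` (with the value `0` where it does not exist). -/
def itoIntegral {X Ω : Type*} [MeasurableSpace X] [MeasurableSpace Ω] {ν : Measure X}
    (P : Measure Ω) (W : Bfin ν → Ω → ℝ) (φ : X → ℝ) : Lp ℝ 2 P :=
  if h : ItoIntegrable P W φ then h.choose else 0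

open Classical in
/-- `𝔼(|∫ φ dW|²) ∈ [0, ∞]`; it is `∞` if the Itô integral does not exist in `L²(P)`. -/
def secondMoment {X Ω : Type*} [MeasurableSpace X] [MeasurableSpace Ω] {ν : Measure X}
    (P : Measure Ω) (W : Bfin ν → Ω → ℝ) (φ : X → ℝ) : ℝ≥0∞ :=
  if ItoIntegrable P W φ then ∫⁻ ω, ‖itoIntegral P W φ ω‖ₑ ^ 2 ∂P else ∞

open Classical in
/-- `𝔼(|∫ φ dW|² ∣ 𝓒_𝒜) ∈ [0, ∞]`: the second moment of the projection `𝔼(∫ φ dW ∣ 𝓒_𝒜)` of the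
Itô integral to the `𝓒_𝒜`-measurable functions in `L²(P)`; it is `∞` if the Itô integral does not
exist in `L²(P)`. -/
def condSecondMoment {X Ω : Type*} [MeasurableSpace X] [MeasurableSpace Ω] {ν : Measure X}
    (P : Measure Ω) (W : Bfin ν → Ω → ℝ) (φ : X → ℝ) (𝒜 : CountablePartition ν) : ℝ≥0∞ :=
  if ItoIntegrable P W φ then
    ∫⁻ ω, ‖(P[itoIntegral P W φ | cylinderAlgebra W 𝒜]) ω‖ₑ ^ 2 ∂P
  else ∞

/-- A Gaussian process has square integrable values, so the generators of `elementaryGraph` exist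
and are determined by the set. -/
theorem exists_toLp {X Ω : Type*} [MeasurableSpace X] [MeasurableSpace Ω] {ν : Measure X}
    {P : Measure Ω} {W : Bfin ν → Ω → ℝ} (hG : IsGaussianProcess W P) (A : Bfin ν) :
    ∃ w : Lp ℝ 2 P, w =ᵐ[P] W A :=
  ⟨MemLp.toLp _ ((hG.hasGaussianLaw_eval A).memLp_two), MemLp.coeFn_toLp _⟩

/-- The Itô integral is well defined. -/
theorem IsItoIntegral.unique {X Ω : Type*} [MeasurableSpace X] [MeasurableSpace Ω] {ν : Measure X}
    {P : Measure Ω} {W : Bfin ν → Ω → ℝ} {S : Lp ℝ 2 ν →ₗ.[ℝ] Lp ℝ 2 ν} (hS : S.IsClosed)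
    {k : Bfin ν → Lp ℝ 2 ν} (hk : ∀ A, (chi ν A, k A) ∈ S.graph)
    (hG : IsGaussianProcess W P)
    (hcov : ∀ A B, ∫ ω, W A ω * W B ω ∂P = ⟪k A, k B⟫_ℝ)
    {φ : X → ℝ} {F F' : Lp ℝ 2 P} (hF : IsItoIntegral P W φ F) (hF' : IsItoIntegral P W φ F') :
    F = F' := by
  choose w hw using exists_toLp hG
  have hww : ∀ A B, ⟪k A, k B⟫_ℝ = ⟪w A, w B⟫_ℝ := by
    intro A B
    rw [← hcov, L2.inner_def]
    apply integral_congr_ae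
    filter_upwards [hw A, hw B] with ω h1 h2
    simp [h1, h2, mul_comm]
  let T : Set (Lp ℝ 2 ν × Lp ℝ 2 ν × Lp ℝ 2 P) := Set.range fun A => (chi ν A, k A, w A)
  have hiso : ∀ q ∈ Submodule.span ℝ T, ∀ q' ∈ Submodule.span ℝ T,
      ⟪q.2.1, q'.2.1⟫_ℝ = ⟪q.2.2, q'.2.2⟫_ℝ := by
    intro q hq q' hq'
    induction hq, hq' using Submodule.span_induction₂ with
    | mem_mem x y hx hy =>
      obtain ⟨A, rfl⟩ := hx
      obtain ⟨B, rfl⟩ := hy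
      exact hww A B
    | zero_left => simp
    | zero_right => simp
    | add_left x y z _ _ _ h1 h2 => simp [inner_add_left, h1, h2]
    | add_right x y z _ _ _ h1 h2 => simp [inner_add_right, h1, h2]
    | smul_left r x y _ _ h => simp [inner_smul_left, h]
    | smul_right r x y _ _ h => simp [inner_smul_right, h]
  have hgr : ∀ q ∈ Submodule.span ℝ T, (q.1, q.2.1) ∈ S.graph := by
    intro q hq
    induction hq using Submodule.span_induction with
    | mem x hx => obtain ⟨A, rfl⟩ := hx; exact hk A
    | zero => exact S.graph.zero_mem
    | add x y _ _ h1 h2 => exact S.graph.add_mem h1 h2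
    | smul r x _ h => exact S.graph.smul_mem r h
  have hlift : ∀ p ∈ elementaryGraph P W, ∃ q ∈ Submodule.span ℝ T, q.1 = p.1 ∧ q.2.2 = p.2 := by
    intro p hp
    induction hp using Submodule.span_induction with
    | mem x hx =>
      obtain ⟨A, h1, h2⟩ := hx
      exact ⟨_, Submodule.subset_span ⟨A, rfl⟩, h1.symm, Lp.ext ((hw A).trans h2.symm)⟩
    | zero => exact ⟨0, Submodule.zero_mem _, rfl, rfl⟩
    | add x y _ _ h1 h2 =>
      obtain ⟨q, hq, a, b⟩ := h1
      obtain ⟨q', hq', a', b'⟩ := h2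
      exact ⟨q + q', Submodule.add_mem _ hq hq', by simp [a, a'], by simp [b, b']⟩
    | smul r x _ h =>
      obtain ⟨q, hq, a, b⟩ := h
      exact ⟨r • q, Submodule.smul_mem _ _ hq, by simp [a], by simp [b]⟩
  obtain ⟨f, hf, hm⟩ := hF
  obtain ⟨f', hf', hm'⟩ := hF'
  have hff : f = f' := Lp.ext (hf.trans hf'.symm)
  subst hff
  have hD : ((0 : Lp ℝ 2 ν), F - F') ∈ (elementaryGraph P W).topologicalClosure := by
    simpa using Submodule.sub_mem _ hm hm'
  rw [← SetLike.mem_coe, Submodule.topologicalClosure_coe, mem_closure_iff_seq_limit] at hD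
  obtain ⟨u, hu, hlim⟩ := hD
  choose q hq hq1 hq2 using fun n => hlift (u n) (hu n)
  have hl1 : Filter.Tendsto (fun n => (q n).1) Filter.atTop (nhds 0) := by
    simp only [hq1]; exact ((continuous_fst.tendsto _).comp hlim)
  have hl2 : Filter.Tendsto (fun n => (q n).2.2) Filter.atTop (nhds (F - F')) := by
    simp only [hq2]; exact ((continuous_snd.tendsto _).comp hlim)
  have hnorm : ∀ q ∈ Submodule.span ℝ T, ‖q.2.1‖ = ‖q.2.2‖ := by
    intro q hq
    rw [norm_eq_sqrt_real_inner, norm_eq_sqrt_real_inner, hiso q hq q hq]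
  have hc : CauchySeq fun n => (q n).2.1 := by
    have := hl2.cauchySeq
    rw [Metric.cauchySeq_iff] at this ⊢
    intro ε hε
    obtain ⟨N, hN⟩ := this ε hε
    refine ⟨N, fun m hm n hn => ?_⟩
    have h1 := hnorm _ (Submodule.sub_mem _ (hq m) (hq n))
    have h2 := hN m hm n hn
    rw [dist_eq_norm] at h2 ⊢
    simpa [h1] using (h1.trans_lt h2)
  obtain ⟨g, hg⟩ := cauchySeq_tendsto_of_complete hc
  have hmem : ((0 : Lp ℝ 2 ν), g) ∈ S.graph :=
    hS.mem_of_tendsto (hl1.prodMk_nhds hg) (Filter.Eventually.of_forall fun n => hgr _ (hq n))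
  have hg0 : g = 0 := S.graph_fst_eq_zero_snd hmem rfl
  subst hg0
  have h3 : Filter.Tendsto (fun n => ‖(q n).2.2‖) Filter.atTop (nhds 0) := by
    have := hg.norm
    simp only [norm_zero] at this
    exact this.congr fun n => hnorm _ (hq n)
  have h4 : ‖F - F'‖ = 0 := tendsto_nhds_unique hl2.norm h3
  exact sub_eq_zero.mp (norm_eq_zero.mp h4)

end

end GaussianField

namespace GaussianField

open Filter Topology

/-! The correspondence between `k A` and `W A` preserves inner products, so closing the elementary
integral amounts to closing the restriction of `S` to `Dfin`; as `Dfin` is a core, this gives back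
`S`. Hence the Itô integral exists exactly on the domain of `S` (`itoIntegrable_iff_inDomain`).

Conditional expectations are orthogonal projections in L², so monotonicity reduces to an inclusion
of closed subspaces. The supremum is found by approximating the integral by elementary ones, each
measurable for a partition subordinate to its finitely many sets.

Both arguments need that, for a countable disjoint union of parts, the variable of the union is a.s.
measurable for those of the parts. Since `S` may be unbounded, convergence of indicators in L²(ν)
does not by itself give convergence of the variables. In `mem_of_countable_disjoint_iUnion`, Baire
category on the space of subfamilies bounds the values on finite unions; weak compactness and the
closed graph then identify the limit. -/

/-! ### Weak compactness and closed graphs. -/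

/-- A closed subspace of `E × F`, `F` a Hilbert space, contains a point over the limit of the first
coordinates as soon as the second coordinates stay bounded. -/
theorem exists_mem_of_tendsto_of_bounded {E F α : Type*} [NormedAddCommGroup E] [NormedSpace ℝ E]
    [NormedAddCommGroup F] [InnerProductSpace ℝ F] [CompleteSpace F]
    (G : Submodule ℝ (E × F)) (hG : IsClosed (G : Set (E × F)))
    {l : Filter α} [l.NeBot] {x : α → E} {y : α → F} {x₀ : E} {N : ℝ}
    (hx : Tendsto x l (𝓝 x₀)) (hy : ∀ a, ‖y a‖ ≤ N) (hxy : ∀ a, (x a, y a) ∈ G) :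
    ∃ y₀, ‖y₀‖ ≤ N ∧ (x₀, y₀) ∈ G := by
  -- Banach–Alaoglu, through the Riesz isomorphism: an ultrafilter yields a weak limit without
  -- extracting subsequences.
  let T : α → WeakDual ℝ F := fun a => StrongDual.toWeakDual (InnerProductSpace.toDual ℝ F (y a))
  have hK := WeakDual.isCompact_closedBall (𝕜 := ℝ) (E := F) 0 N
  let u : Ultrafilter α := Ultrafilter.of l
  have hu : (u : Filter α) ≤ l := Ultrafilter.of_le l
  obtain ⟨z, hz, hlim⟩ := hK.ultrafilter_le_nhds (u.map T) (by
    rw [Ultrafilter.coe_map, le_principal_iff, mem_map]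
    refine Filter.univ_mem' fun a => ?_
    simp only [Set.mem_preimage, Metric.mem_closedBall, dist_zero_right]
    exact ((InnerProductSpace.toDual ℝ F).norm_map (y a)).le.trans (hy a))
  have hT : Tendsto T u (𝓝 z) := by rwa [Ultrafilter.coe_map] at hlim
  let y₀ : F := (InnerProductSpace.toDual ℝ F).symm (WeakDual.toStrongDual z)
  have hweak : ∀ v, Tendsto (fun a => ⟪y a, v⟫_ℝ) u (𝓝 ⟪y₀, v⟫_ℝ) := by
    intro v
    have h := ((WeakDual.eval_continuous v).tendsto z).comp hT
    rw [InnerProductSpace.toDual_symm_apply]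
    exact h
  refine ⟨y₀, ?_, ?_⟩
  · rw [LinearIsometryEquiv.norm_map]
    simpa using hz
  · by_contra hn
    -- A closed subspace is weakly closed: a separating functional is bounded above on `G`, hence
    -- zero there, and it passes to the limit, strong in the first coordinate and weak in the
    -- second.
    obtain ⟨f, r, hf, hr⟩ := geometric_hahn_banach_closed_point G.convex hG hn
    have h0 : ∀ q ∈ G, f q = 0 := by
      intro q hq
      by_contra hne
      have h1 := hf _ (G.smul_mem (r / f q) hq)
      rw [map_smul, smul_eq_mul, div_mul_cancel₀ _ hne] at h1
      exact lt_irrefl _ h1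
    have hr0 : 0 < r := by simpa using hf 0 G.zero_mem
    let g : StrongDual ℝ F := f.comp (ContinuousLinearMap.inr ℝ E F)
    let b : F := (InnerProductSpace.toDual ℝ F).symm g
    have hb : ∀ v, f (0, v) = ⟪v, b⟫_ℝ := by
      intro v
      rw [real_inner_comm, InnerProductSpace.toDual_symm_apply]
      rfl
    have hsplit : ∀ p v, f (p, v) = f (p, 0) + ⟪v, b⟫_ℝ := by
      intro p v
      rw [← hb, ← map_add]
      simp
    have hc : Continuous fun p : E => f (p, (0 : F)) := by fun_prop
    have hl : Tendsto (fun a => f (x a, y a)) u (𝓝 (f (x₀, y₀))) := by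
      rw [hsplit x₀ y₀]
      refine Tendsto.congr (fun a => (hsplit (x a) (y a)).symm) ?_
      exact ((hc.tendsto x₀).comp (hx.mono_left hu)).add (hweak b)
    have h2 : f (x₀, y₀) = 0 :=
      tendsto_nhds_unique hl (by simp only [fun a => h0 _ (hxy a)]; exact tendsto_const_nhds)
    linarith

/-! ### Additive set functions with closed graph. -/

section VectorMeasure

variable {X : Type*} [MeasurableSpace X] {ν : Measure X} {F : Type*} [NormedAddCommGroup F]
  [InnerProductSpace ℝ F] {G : Submodule ℝ (Lp ℝ 2 ν × F)} {k : Bfin ν → F}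

theorem chi_eq_add {A B C : Bfin ν} (hd : Disjoint A.1 B.1) (hC : C.1 = A.1 ∪ B.1) :
    chi ν C = chi ν A + chi ν B := by
  obtain ⟨C, hC'⟩ := C
  obtain rfl : C = A.1 ∪ B.1 := hC
  exact indicatorConstLp_disjoint_union A.2.1 B.2.1 A.2.2.ne B.2.2.ne hd 1

theorem snd_eq_of_mem (hG0 : ∀ y, ((0 : Lp ℝ 2 ν), y) ∈ G → y = 0) {x : Lp ℝ 2 ν} {y y' : F}
    (h : (x, y) ∈ G) (h' : (x, y') ∈ G) : y = y' := by
  have := G.sub_mem h h'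
  exact sub_eq_zero.mp (hG0 _ (by simpa using this))

theorem eq_add_of_disjoint (hG0 : ∀ y, ((0 : Lp ℝ 2 ν), y) ∈ G → y = 0)
    (hk : ∀ A, (chi ν A, k A) ∈ G) {A B C : Bfin ν} (hd : Disjoint A.1 B.1)
    (hC : C.1 = A.1 ∪ B.1) : k C = k A + k B := by
  refine snd_eq_of_mem hG0 (hk C) ?_
  rw [chi_eq_add hd hC]
  exact G.add_mem (hk A) (hk B)

/-- The union of the sets `s i` with `c i = true`. -/
def selUnion {ι : Type*} [Countable ι] (s : ι → Set X) (hs : ∀ i, MeasurableSet (s i))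
    (hfin : ν (⋃ i, s i) < ∞) (c : ι → Bool) : Bfin ν :=
  ⟨⋃ i ∈ {i | c i = true}, s i, MeasurableSet.biUnion (Set.to_countable _) fun i _ => hs i,
    (measure_mono (Set.iUnion₂_subset fun i _ => Set.subset_iUnion s i)).trans_lt hfin⟩

variable {ι : Type*} [Countable ι] {s : ι → Set X} {hs : ∀ i, MeasurableSet (s i)}
  {hfin : ν (⋃ i, s i) < ∞}

theorem mem_selUnion {c : ι → Bool} {x : X} :
    x ∈ (selUnion s hs hfin c).1 ↔ ∃ i, c i = true ∧ x ∈ s i := by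
  simp [selUnion]

/-- Selections agreeing on a finite set of indices give unions that differ only inside the tail of
the family, and the tail is small because the total measure is finite. -/
theorem continuous_chi_selUnion (hd : Pairwise (Function.onFun Disjoint s)) :
    Continuous fun c : ι → Bool => chi ν (selUnion s hs hfin c) := by
  refine continuous_indicatorConstLp_set (by simp) fun c => ?_
  have hsum : ∑' i, ν (s i) ≠ ∞ := by
    rw [← measure_iUnion hd hs]
    exact hfin.ne
  have htail := ENNReal.tendsto_tsum_compl_atTop_zero hsum
  rw [ENNReal.tendsto_nhds_zero] at htail ⊢
  intro ε hε
  obtain ⟨I, hI⟩ := (htail ε hε).exists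
  have hopen : ∀ᶠ c' in 𝓝 c, ∀ i ∈ I, c' i = c i := by
    rw [Filter.eventually_all_finset]
    intro i _
    exact (continuous_apply i).continuousAt.preimage_mem_nhds
      ((isOpen_discrete {c i}).mem_nhds rfl)
  filter_upwards [hopen] with c' hc'
  refine le_trans ?_ hI
  refine le_trans (measure_mono ?_) (measure_iUnion_le fun i : {i // i ∉ I} => s i)
  rintro x (⟨h1, h2⟩ | ⟨h1, h2⟩) <;> rw [mem_selUnion] at h1 h2 <;>
    obtain ⟨i, hi, hx⟩ := h1 <;>
    refine Set.mem_iUnion.2 ⟨⟨i, fun hiI => h2 ⟨i, ?_, hx⟩⟩, hx⟩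
  · rw [← hc' i hiI, hi]
  · rw [hc' i hiI, hi]

/-- An additive set function with closed graph is bounded on the sets which avoid finitely many
members of a countable disjoint family. -/
theorem exists_bound_selUnion [CompleteSpace F] (hG : IsClosed (G : Set (Lp ℝ 2 ν × F)))
    (hG0 : ∀ y, ((0 : Lp ℝ 2 ν), y) ∈ G → y = 0)
    (hk : ∀ A, (chi ν A, k A) ∈ G) (hd : Pairwise (Function.onFun Disjoint s)) :
    ∃ (I : Finset ι) (M : ℝ), ∀ c : ι → Bool, (∀ i ∈ I, c i = false) →
      ‖k (selUnion s hs hfin c)‖ ≤ M := by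
  let D : ℕ → Set (ι → Bool) := fun n => {c | ‖k (selUnion s hs hfin c)‖ ≤ n}
  -- Along selections in `D n` the values are bounded, so some point of the graph lies over the
  -- limiting indicator with the same bound; single-valuedness makes it the value of `k` there.
  have hcl : ∀ n, IsClosed (D n) := by
    intro n
    refine isClosed_of_closure_subset fun c hc => ?_
    have := mem_closure_iff_comap_neBot.1 hc
    obtain ⟨y, hy, hm⟩ := exists_mem_of_tendsto_of_bounded G hG (N := n)
      (l := comap ((↑) : D n → ι → Bool) (𝓝 c))
      (((continuous_chi_selUnion (hs := hs) (hfin := hfin) hd).tendsto c).comp tendsto_comap)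
      (fun a => a.2) (fun a => hk _)
    show ‖k (selUnion s hs hfin c)‖ ≤ n
    rwa [snd_eq_of_mem hG0 (hk _) hm]
  have hU : ⋃ n, D n = Set.univ := by
    refine Set.eq_univ_of_forall fun c => Set.mem_iUnion.2 ?_
    exact exists_nat_ge ‖k (selUnion s hs hfin c)‖
  -- Baire category in the compact space `ι → Bool`: some `D n` contains a cylinder around `c₀`,
  -- fixed by finitely many indices `I`.
  obtain ⟨n, c₀, hc₀⟩ := nonempty_interior_of_iUnion_of_closed hcl hU
  rw [mem_interior_iff_mem_nhds, nhds_pi, Filter.mem_pi] at hc₀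
  obtain ⟨I, hI, t, ht, hsub⟩ := hc₀
  classical
  let a : ι → Bool := fun i => if i ∈ I then c₀ i else false
  refine ⟨hI.toFinset, n + ‖k (selUnion s hs hfin a)‖, fun c hc => ?_⟩
  -- `b` lies in the cylinder, and its union is the disjoint union of those of `a` and `c`;
  -- subtracting the fixed value at `a` bounds the value at `c`.
  let b : ι → Bool := fun i => if i ∈ I then c₀ i else c i
  have hb : b ∈ D n := by
    refine hsub fun i hi => ?_
    simp only [b, if_pos hi]
    exact mem_of_mem_nhds (ht i)
  have hc' : ∀ i ∈ I, c i = false := fun i hi => hc i (hI.mem_toFinset.2 hi)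
  have hadd : k (selUnion s hs hfin b) = k (selUnion s hs hfin a) + k (selUnion s hs hfin c) := by
    refine eq_add_of_disjoint hG0 hk ?_ ?_
    · rw [Set.disjoint_left]
      intro x h1 h2
      rw [mem_selUnion] at h1 h2
      obtain ⟨i, hi, hxi⟩ := h1
      obtain ⟨j, hj, hxj⟩ := h2
      have hij : i = j := by
        by_contra hne
        exact Set.disjoint_left.1 (hd hne) hxi hxj
      subst hij
      by_cases h : i ∈ I
      · simp [hc' i h] at hj
      · simp [a, h] at hi
    · ext x
      rw [Set.mem_union, mem_selUnion, mem_selUnion, mem_selUnion, ← exists_or]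
      refine exists_congr fun i => ?_
      by_cases h : i ∈ I
      · simp [a, b, h, hc' i h]
      · simp [a, b, h]
  have h1 : k (selUnion s hs hfin c) = k (selUnion s hs hfin b) - k (selUnion s hs hfin a) := by
    rw [hadd]; abel
  rw [h1]
  exact (norm_sub_le _ _).trans (add_le_add_left hb _)

/-- An additive set function with closed graph takes on a countable disjoint union a value in the
closed span of its values on the pieces. -/
theorem mem_of_countable_disjoint_iUnion [CompleteSpace F]
    (hG : IsClosed (G : Set (Lp ℝ 2 ν × F)))
    (hG0 : ∀ y, ((0 : Lp ℝ 2 ν), y) ∈ G → y = 0)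
    (hk : ∀ A, (chi ν A, k A) ∈ G) {A : Bfin ν} {t : ι → Bfin ν}
    (hd : Pairwise (Function.onFun Disjoint fun i => (t i).1)) (hA : A.1 = ⋃ i, (t i).1)
    {M : Submodule ℝ F} (hM : IsClosed (M : Set F)) (ht : ∀ i, k (t i) ∈ M) : k A ∈ M := by
  classical
  have hfin : ν (⋃ i, (t i).1) < ∞ := hA ▸ A.2.2
  have hs : ∀ i, MeasurableSet (t i).1 := fun i => (t i).2.1
  let U : (ι → Bool) → Bfin ν := selUnion (fun i => (t i).1) hs hfin
  let e : Finset ι → ι → Bool := fun J i => decide (i ∈ J)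
  have hmem : ∀ J : Finset ι, k (U (e J)) ∈ M := by
    intro J
    induction J using Finset.induction_on with
    | empty =>
      have h0 : chi ν (U (e ∅)) = 0 := by
        have : U (e ∅) = ⟨∅, MeasurableSet.empty, by simp⟩ := by
          apply Subtype.ext
          ext x
          simp [U, e, mem_selUnion]
        rw [this]
        exact indicatorConstLp_empty
      have h1 := hk (U (e ∅))
      rw [h0] at h1
      rw [hG0 _ h1]
      exact M.zero_mem
    | insert j J hj ih =>
      rw [eq_add_of_disjoint hG0 hk (A := t j) (B := U (e J))]
      · exact M.add_mem (ht j) ih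
      · rw [Set.disjoint_left]
        intro x hx hx'
        obtain ⟨i, hi, hxi⟩ := mem_selUnion.1 hx'
        have hij : j ≠ i := by
          rintro rfl
          simp [e, hj] at hi
        exact Set.disjoint_left.1 (hd hij) hx hxi
      · ext x
        simp [U, e, mem_selUnion]
  obtain ⟨I, C, hC⟩ := exists_bound_selUnion (hs := hs) (hfin := hfin) hG hG0 hk hd
  have hlim : Tendsto (fun J => chi ν (U (e J))) atTop (𝓝 (chi ν A)) := by
    have hA' : A = U fun _ => true := by
      apply Subtype.ext
      ext x
      simp [U, mem_selUnion, hA]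
    rw [hA']
    refine ((continuous_chi_selUnion hd).tendsto _).comp (tendsto_pi_nhds.2 fun i => ?_)
    refine tendsto_const_nhds.congr' ?_
    filter_upwards [eventually_ge_atTop {i}] with J hJ
    have : i ∈ J := hJ (by simp)
    simp [e, this]
  -- `J \ I` avoids `I`, so `C` applies; `J ∩ I` is one of the finitely many subsets of `I`, all
  -- covered by the sum.
  have hbound : ∀ J, ‖k (U (e J))‖ ≤ C + ∑ K ∈ I.powerset, ‖k (U (e K))‖ := by
    intro J
    have hadd : k (U (e J)) = k (U (e (J \ I))) + k (U (e (J ∩ I))) := by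
      refine eq_add_of_disjoint hG0 hk ?_ ?_
      · rw [Set.disjoint_left]
        intro x h1 h2
        obtain ⟨i, hi, hxi⟩ := mem_selUnion.1 h1
        obtain ⟨j, hj, hxj⟩ := mem_selUnion.1 h2
        have hij : i ≠ j := by
          rintro rfl
          simp only [e, decide_eq_true_eq, Finset.mem_sdiff, Finset.mem_inter] at hi hj
          exact hi.2 hj.2
        exact Set.disjoint_left.1 (hd hij) hxi hxj
      · ext x
        rw [Set.mem_union, mem_selUnion, mem_selUnion, mem_selUnion, ← exists_or]
        refine exists_congr fun i => ?_
        by_cases h : i ∈ I <;> simp [e, h]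
    rw [hadd]
    refine (norm_add_le _ _).trans (add_le_add (hC _ fun i hi => by simp [e, hi]) ?_)
    exact Finset.single_le_sum (f := fun K => ‖k (U (e K))‖) (fun K _ => norm_nonneg _)
      (Finset.mem_powerset.2 Finset.inter_subset_right)
  -- Intersecting the graph with the condition that the second coordinate is in `M` keeps it closed,
  -- so the weak limit stays in `M`; no norm convergence is needed.
  obtain ⟨y, -, hy⟩ := exists_mem_of_tendsto_of_bounded (G ⊓ (⊤ : Submodule ℝ _).prod M)
    (hG.inter (by
      have : IsClosed {q : Lp ℝ 2 ν × F | q.2 ∈ (M : Set F)} := hM.preimage continuous_snd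
      convert this using 1
      ext q
      simp)) hlim hbound
    (fun J => ⟨hk _, Submodule.mem_prod.2 ⟨Submodule.mem_top, hmem J⟩⟩)
  rw [snd_eq_of_mem hG0 (hk A) hy.1]
  exact (Submodule.mem_prod.1 hy.2).2

end VectorMeasure

/-! ### Conditional expectation as orthogonal projection. -/

section ConditionalExpectation

variable {Ω : Type*} {m m' : MeasurableSpace Ω} {mΩ : MeasurableSpace Ω} {P : Measure Ω}

/-- A function measurable for the sigma-algebra of countably many random variables is, up to null
sets, measurable for every sigma-algebra for which these variables are almost surely measurable. -/
theorem aestronglyMeasurable_of_iSup_comap {ι : Type*} [Countable ι] {W : ι → Ω → ℝ}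
    (hW : ∀ i, AEStronglyMeasurable[m] (W i) P) {f : Ω → ℝ}
    (hf : AEStronglyMeasurable[⨆ i, MeasurableSpace.comap (W i) inferInstance] f P) :
    AEStronglyMeasurable[m] f P := by
  obtain ⟨g, hg, hfg⟩ := hf
  have hcomap : (⨆ i, MeasurableSpace.comap (W i) inferInstance : MeasurableSpace Ω) =
      MeasurableSpace.comap (fun ω i => W i ω) MeasurableSpace.pi := by
    simp only [MeasurableSpace.pi, MeasurableSpace.comap_iSup, MeasurableSpace.comap_comp]
    rfl
  rw [hcomap] at hg
  -- Doob–Dynkin factorization; countability of `ι` then allows replacing all variables by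
  -- `m`-measurable versions off one null set.
  obtain ⟨h, hh, rfl⟩ := hg.exists_eq_measurable_comp
  refine ⟨fun ω => h fun i => (hW i).mk (W i) ω, ?_, ?_⟩
  · have hV : Measurable[m] fun ω i => (hW i).mk (W i) ω :=
      @measurable_pi_lambda _ _ _ m _ _ fun i => (hW i).stronglyMeasurable_mk.measurable
    exact (hh.measurable.comp hV).stronglyMeasurable
  · filter_upwards [hfg, ae_all_iff.2 fun i => (hW i).ae_eq_mk] with ω h1 h2
    rw [h1]
    simp only [Function.comp_apply]
    congr 1
    funext i
    exact h2 i

theorem lintegral_enorm_sq_eq (F : Lp ℝ 2 P) : ∫⁻ ω, ‖F ω‖ₑ ^ 2 ∂P = ‖F‖ₑ ^ 2 := by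
  rw [Lp.enorm_def, eLpNorm_eq_lintegral_rpow_enorm_toReal (by simp) (by simp)]
  simp only [ENNReal.toReal_ofNat, ENNReal.rpow_ofNat]
  rw [← ENNReal.rpow_natCast, ← ENNReal.rpow_mul]
  simp

theorem lintegral_enorm_condExp_sq_eq [IsFiniteMeasure P] (hm : m ≤ mΩ)
    (F : Lp ℝ 2 P) : ∫⁻ ω, ‖(P[F | m]) ω‖ₑ ^ 2 ∂P = ‖condExpL2 ℝ ℝ hm F‖ₑ ^ 2 := by
  have h := (Lp.memLp F).condExpL2_ae_eq_condExp (𝕜 := ℝ) hm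
  rw [Lp.toLp_coeFn] at h
  have h2 := lintegral_enorm_sq_eq (condExpL2 ℝ ℝ hm F : Lp ℝ 2 P)
  refine Eq.trans (lintegral_congr_ae ?_) h2
  filter_upwards [h] with ω hω
  rw [hω]

/-- Projecting onto the smaller subspace factors through the larger one. Comparing L² subspaces
tolerates null sets, whereas the sigma-algebras themselves need not be nested. -/
theorem norm_condExpL2_le_of_lpMeas_le (hm : m ≤ mΩ) (hm' : m' ≤ mΩ)
    (hle : lpMeas ℝ ℝ m 2 P ≤ lpMeas ℝ ℝ m' 2 P) (F : Lp ℝ 2 P) :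
    ‖condExpL2 ℝ ℝ hm F‖ ≤ ‖condExpL2 ℝ ℝ hm' F‖ := by
  have : Fact (m ≤ mΩ) := ⟨hm⟩
  have : Fact (m' ≤ mΩ) := ⟨hm'⟩
  have h := Submodule.orthogonalProjectionOnto_starProjection_of_le hle F
  show ‖(lpMeas ℝ ℝ m 2 P).orthogonalProjectionOnto F‖ ≤ _
  rw [← h]
  exact Submodule.norm_orthogonalProjectionOnto_apply_le _ _

/-- The projection is a contraction fixing `F'`; passing from `F` to `F'` and back costs the
distance twice. -/
theorem norm_sub_le_norm_condExpL2 (hm : m ≤ mΩ) (F : Lp ℝ 2 P)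
    {F' : Lp ℝ 2 P} (hF' : F' ∈ lpMeas ℝ ℝ m 2 P) :
    ‖F‖ - 2 * ‖F - F'‖ ≤ ‖condExpL2 ℝ ℝ hm F‖ := by
  have : Fact (m ≤ mΩ) := ⟨hm⟩
  have h1 : ((condExpL2 ℝ ℝ hm F' : lpMeas ℝ ℝ m 2 P) : Lp ℝ 2 P) = F' :=
    Submodule.starProjection_eq_self_iff.2 hF'
  have h2 : ‖F'‖ ≤ ‖condExpL2 ℝ ℝ hm F‖ + ‖F' - F‖ := by
    calc ‖F'‖ = ‖condExpL2 ℝ ℝ hm F'‖ := by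
          conv_lhs => rw [← h1]
          rfl
      _ = ‖condExpL2 ℝ ℝ hm F + condExpL2 ℝ ℝ hm (F' - F)‖ := by rw [← map_add]; simp
      _ ≤ _ := (norm_add_le _ _).trans (add_le_add_right (norm_condExpL2_le hm _) _)
  have h3 := norm_sub_norm_le F F'
  rw [norm_sub_rev F' F] at h2
  linarith

end ConditionalExpectation

/-! ### The domain of the Itô integral. -/

section Isometry

/-- If the last two coordinates have equal norms on a subspace, then the points in the closure of
its projection to the first two coordinates lift to the last one. -/
theorem exists_mem_closure_of_norm_eq {E F G : Type*} [NormedAddCommGroup E] [NormedSpace ℝ E]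
    [NormedAddCommGroup F] [NormedSpace ℝ F] [NormedAddCommGroup G] [NormedSpace ℝ G]
    [CompleteSpace G] {V : Submodule ℝ (E × F × G)} (hV : ∀ q ∈ V, ‖q.2.1‖ = ‖q.2.2‖)
    {A : Set (E × F)} {B : Set (E × G)} (hA : ∀ p ∈ A, ∃ q ∈ V, q.1 = p.1 ∧ q.2.1 = p.2)
    (hB : ∀ q ∈ V, (q.1, q.2.2) ∈ B) {x : E} {y : F} (hxy : (x, y) ∈ closure A) :
    ∃ z, (x, z) ∈ closure B := by
  rw [mem_closure_iff_seq_limit] at hxy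
  obtain ⟨u, hu, hlim⟩ := hxy
  choose q hq hq1 hq2 using fun n => hA (u n) (hu n)
  have hl1 : Tendsto (fun n => (q n).1) atTop (𝓝 x) := by
    simp only [hq1]; exact (continuous_fst.tendsto _).comp hlim
  have hl2 : Tendsto (fun n => (q n).2.1) atTop (𝓝 y) := by
    simp only [hq2]; exact (continuous_snd.tendsto _).comp hlim
  have hc : CauchySeq fun n => (q n).2.2 := by
    have := hl2.cauchySeq
    rw [Metric.cauchySeq_iff] at this ⊢
    intro ε hε
    obtain ⟨N, hN⟩ := this ε hε
    refine ⟨N, fun m hm n hn => ?_⟩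
    have h1 := hV _ (Submodule.sub_mem _ (hq m) (hq n))
    have h2 := hN m hm n hn
    rw [dist_eq_norm] at h2 ⊢
    exact h1.symm.trans_lt h2
  obtain ⟨z, hz⟩ := cauchySeq_tendsto_of_complete hc
  exact ⟨z, mem_closure_of_tendsto (hl1.prodMk_nhds hz) (Eventually.of_forall fun n => hB _ (hq n))⟩

variable {X Ω : Type*} [MeasurableSpace X] [MeasurableSpace Ω] {ν : Measure X} {P : Measure Ω}
  {S : Lp ℝ 2 ν →ₗ.[ℝ] Lp ℝ 2 ν} {k : Bfin ν → Lp ℝ 2 ν} {W : Bfin ν → Ω → ℝ}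

/-- The Itô integrable functions are the ones in the domain of `S`. -/
theorem itoIntegrable_iff_inDomain (hS : S.IsClosed) (hcore : S.HasCore (Dfin ν))
    (hk : ∀ A, (chi ν A, k A) ∈ S.graph) (hG : IsGaussianProcess W P)
    (hcov : ∀ A B, ∫ ω, W A ω * W B ω ∂P = ⟪k A, k B⟫_ℝ) (φ : X → ℝ) :
    ItoIntegrable P W φ ↔ InDomain S φ := by
  choose w hw using exists_toLp hG
  have hww : ∀ A B, ⟪k A, k B⟫_ℝ = ⟪w A, w B⟫_ℝ := by
    intro A B
    rw [← hcov, L2.inner_def]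
    apply integral_congr_ae
    filter_upwards [hw A, hw B] with ω h1 h2
    simp [h1, h2, mul_comm]
  -- One span of triples projects onto both elementary graphs, so linear relations among the `k A`
  -- need not be compared with those among the `w A`.
  set V : Submodule ℝ (Lp ℝ 2 ν × Lp ℝ 2 ν × Lp ℝ 2 P) :=
    Submodule.span ℝ (Set.range fun A => (chi ν A, k A, w A)) with hspan
  have hiso : ∀ q ∈ V, ∀ q' ∈ V, ⟪q.2.1, q'.2.1⟫_ℝ = ⟪q.2.2, q'.2.2⟫_ℝ := by
    intro q hq q' hq'
    rw [hspan] at hq hq'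
    induction hq, hq' using Submodule.span_induction₂ with
    | mem_mem x y hx hy =>
      obtain ⟨A, rfl⟩ := hx
      obtain ⟨B, rfl⟩ := hy
      exact hww A B
    | zero_left => simp
    | zero_right => simp
    | add_left x y z _ _ _ h1 h2 => simp [inner_add_left, h1, h2]
    | add_right x y z _ _ _ h1 h2 => simp [inner_add_right, h1, h2]
    | smul_left r x y _ _ h => simp [inner_smul_left, h]
    | smul_right r x y _ _ h => simp [inner_smul_right, h]
  have hnorm : ∀ q ∈ V, ‖q.2.1‖ = ‖q.2.2‖ := by
    intro q hq
    rw [norm_eq_sqrt_real_inner, norm_eq_sqrt_real_inner, hiso q hq q hq]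
  let p₁ : Lp ℝ 2 ν × Lp ℝ 2 ν × Lp ℝ 2 P →ₗ[ℝ] Lp ℝ 2 ν × Lp ℝ 2 ν :=
    LinearMap.prodMap LinearMap.id (LinearMap.fst ℝ _ _)
  let p₂ : Lp ℝ 2 ν × Lp ℝ 2 ν × Lp ℝ 2 P →ₗ[ℝ] Lp ℝ 2 ν × Lp ℝ 2 P :=
    LinearMap.prodMap LinearMap.id (LinearMap.snd ℝ _ _)
  have hV₂ : V.map p₂ = elementaryGraph P W := by
    rw [hspan, Submodule.map_span, elementaryGraph]
    congr 1
    ext ⟨a, b⟩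
    constructor
    · rintro ⟨_, ⟨A, rfl⟩, h⟩
      obtain ⟨rfl, rfl⟩ := Prod.ext_iff.1 h
      exact ⟨A, rfl, hw A⟩
    · rintro ⟨A, h1, h2⟩
      exact ⟨_, ⟨A, rfl⟩, Prod.ext h1.symm (Lp.ext ((hw A).trans h2.symm))⟩
  have hV₁ : V.map p₁ = (S.domRestrict (Dfin ν)).graph := by
    have hle : V.map p₁ ≤ S.graph := by
      rw [hspan, Submodule.map_span, Submodule.span_le]
      rintro _ ⟨_, ⟨A, rfl⟩, rfl⟩
      exact hk A
    have hfst : (V.map p₁).map (LinearMap.fst ℝ _ _) = Dfin ν := by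
      rw [hspan, Submodule.map_span, Submodule.map_span, Dfin]
      rw [← Set.range_comp, ← Set.range_comp]
      rfl
    have hres : ∀ a b, (a, b) ∈ (S.domRestrict (Dfin ν)).graph ↔ (a, b) ∈ S.graph ∧ a ∈ Dfin ν := by
      intro a b
      constructor
      · intro h
        refine ⟨LinearPMap.le_graph_of_le LinearPMap.domRestrict_le h, ?_⟩
        exact (LinearPMap.mem_domain_of_mem_graph h).1
      · rintro ⟨h, ha⟩
        obtain ⟨y, hy1, hy2⟩ := (LinearPMap.mem_graph_iff _).1 h
        refine (LinearPMap.mem_graph_iff _).2 ⟨⟨a, ⟨ha, hcore.le_domain ha⟩⟩, rfl, ?_⟩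
        rw [← hy2]
        exact LinearPMap.domRestrict_apply (by simpa using hy1.symm)
    ext ⟨a, b⟩
    rw [hres]
    constructor
    · intro h
      exact ⟨hle h, hfst ▸ ⟨_, h, rfl⟩⟩
    · rintro ⟨h, ha⟩
      rw [← hfst] at ha
      obtain ⟨⟨a', b'⟩, h', rfl⟩ := ha
      have h3 := S.graph.sub_mem (hle h') h
      have h4 : b' - b = 0 := S.graph_fst_eq_zero_snd h3 (by simp)
      rw [← sub_eq_zero.1 h4]
      exact h'
  have hgraph : (V.map p₁).topologicalClosure = S.graph := by
    rw [hV₁]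
    have hcl : (S.domRestrict (Dfin ν)).IsClosable :=
      (hS.isClosable).leIsClosable LinearPMap.domRestrict_le
    rw [hcl.graph_closure_eq_closure_graph, hcore.closure_eq]
  constructor
  · rintro ⟨F, f, hf, hF⟩
    rw [← hV₂] at hF
    -- Swapping the last two coordinates lets the same lifting lemma run from `W` back to `S`.
    let σ : Lp ℝ 2 ν × Lp ℝ 2 ν × Lp ℝ 2 P →ₗ[ℝ] Lp ℝ 2 ν × Lp ℝ 2 P × Lp ℝ 2 ν :=
      LinearMap.prodMap LinearMap.id (LinearEquiv.prodComm ℝ _ _).toLinearMap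
    obtain ⟨g, hg⟩ := exists_mem_closure_of_norm_eq (V := V.map σ)
      (A := (V.map p₂ : Submodule ℝ _)) (B := (V.map p₁ : Submodule ℝ _))
      (by rintro _ ⟨q, hq, rfl⟩; exact (hnorm q hq).symm)
      (by rintro _ ⟨q, hq, rfl⟩; exact ⟨σ q, ⟨q, hq, rfl⟩, rfl, rfl⟩)
      (by rintro _ ⟨q, hq, rfl⟩; exact ⟨q, hq, rfl⟩) hF
    rw [← Submodule.topologicalClosure_coe, SetLike.mem_coe, hgraph] at hg
    exact ⟨f, LinearPMap.mem_domain_of_mem_graph hg, hf⟩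
  · rintro ⟨f, hfS, hf⟩
    have hg : (f, S ⟨f, hfS⟩) ∈ (V.map p₁).topologicalClosure := by
      rw [hgraph]
      exact S.mem_graph ⟨f, hfS⟩
    obtain ⟨F, hF⟩ := exists_mem_closure_of_norm_eq (V := V)
      (A := (V.map p₁ : Submodule ℝ _)) (B := (V.map p₂ : Submodule ℝ _)) hnorm
      (by rintro _ ⟨q, hq, rfl⟩; exact ⟨q, hq, rfl, rfl⟩)
      (by intro q hq; exact ⟨q, hq, rfl⟩) hg
    refine ⟨F, f, hf, ?_⟩
    rw [← hV₂]
    exact hF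

end Isometry

/-! ### Partitions subordinate to finitely many sets. -/

section Partition

variable {X : Type*} [MeasurableSpace X] {ν : Measure X}

/-- There is a countable partition of which each of finitely many given sets is a union of parts. -/
theorem exists_partition_subordinate [SigmaFinite ν] (T : Finset (Bfin ν)) :
    ∃ 𝒜 : CountablePartition ν, ∀ A ∈ T, ∀ B ∈ 𝒜.parts, B ⊆ A.1 ∨ Disjoint B A.1 := by
  classical
  -- The level sets are the atoms of the algebra generated by `T`, cut by the index of a
  -- finite-measure exhaustion; the codomain is countable.
  let h : X → (T → Bool) × ℕ := fun x =>
    (fun A => decide (x ∈ A.1.1), spanningSetsIndex ν x)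
  have hmeas : Measurable h := by
    refine Measurable.prodMk (measurable_pi_lambda _ fun A => ?_) (measurableSet_spanningSetsIndex ν)
    refine measurable_to_bool ?_
    convert A.1.2.1 using 1
    ext x
    simp
  have hparts : ∀ B ∈ (Setoid.ker h).classes, ∃ p, B = h ⁻¹' {p} := by
    rintro B ⟨y, rfl⟩
    exact ⟨h y, rfl⟩
  refine ⟨⟨(Setoid.ker h).classes, ?_, Setoid.isPartition_classes _, ?_⟩, ?_⟩
  · refine (Set.countable_range fun p => h ⁻¹' {p}).mono ?_
    intro B hB
    obtain ⟨p, rfl⟩ := hparts B hB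
    exact ⟨p, rfl⟩
  · intro B hB
    obtain ⟨p, rfl⟩ := hparts B hB
    refine ⟨hmeas (measurableSet_singleton p), ?_⟩
    refine (measure_mono ?_).trans_lt (measure_spanningSets_lt_top ν p.2)
    rintro x rfl
    exact mem_spanningSetsIndex ν x
  · intro A hA B hB
    obtain ⟨p, rfl⟩ := hparts B hB
    have key : ∀ x ∈ h ⁻¹' {p}, (x ∈ A.1 ↔ p.1 ⟨A, hA⟩ = true) := by
      rintro x rfl
      simp [h]
    by_cases hp : p.1 ⟨A, hA⟩ = true
    · exact Or.inl fun x hx => (key x hx).2 hp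
    · exact Or.inr (Set.disjoint_left.2 fun x hx hxA => hp ((key x hx).1 hxA))

theorem CountablePartition.RefinedBy.subset_or_disjoint {𝒜 𝒜' : CountablePartition ν}
    (h : 𝒜.RefinedBy 𝒜') {A : Set X} (hA : A ∈ 𝒜.parts) {B : Set X} (hB : B ∈ 𝒜'.parts) :
    B ⊆ A ∨ Disjoint B A := by
  obtain ⟨A', hA', hBA⟩ := h B hB
  by_cases hAA : A' = A
  · exact Or.inl (hAA ▸ hBA)
  · exact Or.inr ((𝒜.isPartition.pairwiseDisjoint hA' hA hAA).mono_left hBA)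

end Partition

/-! ### Measurability with respect to partitions. -/

section Ito

variable {X Ω : Type*} [MeasurableSpace X] [mΩ : MeasurableSpace Ω] {ν : Measure X} {P : Measure Ω}
  {W : Bfin ν → Ω → ℝ} {w : Bfin ν → Lp ℝ 2 P}

theorem cylinderAlgebra_le (hW : ∀ A, Measurable (W A)) (𝒜 : CountablePartition ν) :
    cylinderAlgebra W 𝒜 ≤ mΩ :=
  iSup_le fun A => (hW A.1).comap_le

/-- The variable of a union of parts of a partition is almost surely measurable for the sigma-algebra
of the partition. -/
theorem mem_lpMeas_of_subset_or_disjoint (hW : ∀ A, Measurable (W A)) (hw : ∀ A, w A =ᵐ[P] W A)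
    (huniq : ∀ F : Lp ℝ 2 P, ((0 : Lp ℝ 2 ν), F) ∈ (elementaryGraph P W).topologicalClosure → F = 0)
    (𝒜 : CountablePartition ν) {A : Bfin ν}
    (hA : ∀ B ∈ 𝒜.parts, B ⊆ A.1 ∨ Disjoint B A.1) :
    w A ∈ lpMeas ℝ ℝ (cylinderAlgebra W 𝒜) 2 P := by
  have := 𝒜.countable.mono (s₁ := {B | B ∈ 𝒜.parts ∧ B ⊆ A.1}) fun B hB => hB.1
  have : Countable {B | B ∈ 𝒜.parts ∧ B ⊆ A.1} := this.to_subtype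
  refine mem_of_countable_disjoint_iUnion (G := (elementaryGraph P W).topologicalClosure)
    (t := fun B : {B | B ∈ 𝒜.parts ∧ B ⊆ A.1} => (⟨B.1, 𝒜.mem_Bfin _ B.2.1⟩ : Bfin ν))
    (Submodule.isClosed_topologicalClosure _) huniq
    (fun B => Submodule.le_topologicalClosure _ (Submodule.subset_span ⟨B, rfl, hw B⟩))
    ?_ ?_ ?_ ?_
  · intro B C hBC
    exact 𝒜.isPartition.pairwiseDisjoint B.2.1 C.2.1 fun h => hBC (Subtype.ext h)
  · apply Set.Subset.antisymm
    · intro x hx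
      obtain ⟨B, ⟨hB, hxB⟩, -⟩ := 𝒜.isPartition.2 x
      refine Set.mem_iUnion.2 ⟨⟨B, hB, (hA B hB).resolve_right fun h => ?_⟩, hxB⟩
      exact Set.disjoint_left.1 h hxB hx
    · exact Set.iUnion_subset fun B => B.2.2
  · exact isClosed_aestronglyMeasurable (cylinderAlgebra_le hW 𝒜)
  · intro B
    refine mem_lpMeas_iff_aestronglyMeasurable.2 (AEStronglyMeasurable.congr ?_ (hw _).symm)
    refine Measurable.aestronglyMeasurable ?_
    exact (comap_measurable _).mono (le_iSup (fun A : {A : Bfin ν // A.1 ∈ 𝒜.parts} =>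
      MeasurableSpace.comap (W A.1) inferInstance) ⟨_, B.2.1⟩) le_rfl

/-- Each part of the coarser partition is a countable union of finer parts, so its variable is a.s.
measurable for the finer sigma-algebra. -/
theorem lpMeas_cylinderAlgebra_mono (hW : ∀ A, Measurable (W A)) (hw : ∀ A, w A =ᵐ[P] W A)
    (huniq : ∀ F : Lp ℝ 2 P, ((0 : Lp ℝ 2 ν), F) ∈ (elementaryGraph P W).topologicalClosure → F = 0)
    {𝒜 𝒜' : CountablePartition ν} (h : 𝒜.RefinedBy 𝒜') :
    lpMeas ℝ ℝ (cylinderAlgebra W 𝒜) 2 P ≤ lpMeas ℝ ℝ (cylinderAlgebra W 𝒜') 2 P := by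
  intro F hF
  rw [mem_lpMeas_iff_aestronglyMeasurable] at hF ⊢
  have : Countable {A : Bfin ν // A.1 ∈ 𝒜.parts} := by
    have := 𝒜.countable.to_subtype
    exact Function.Injective.countable (β := 𝒜.parts) (f := fun A => ⟨A.1.1, A.2⟩)
      fun A B hAB => Subtype.ext (Subtype.ext (by simpa using hAB))
  refine aestronglyMeasurable_of_iSup_comap
    (W := fun A : {A : Bfin ν // A.1 ∈ 𝒜.parts} => W A.1) (fun A => ?_) hF
  exact (mem_lpMeas_iff_aestronglyMeasurable.1 (mem_lpMeas_of_subset_or_disjoint hW hw huniq 𝒜'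
    fun B hB => h.subset_or_disjoint A.2 hB)).congr (hw A.1)

/-- An Itô integral is, up to an arbitrarily small error, measurable for the sigma-algebra of some
partition. -/
theorem exists_mem_lpMeas_norm_sub_lt [SigmaFinite ν] (hW : ∀ A, Measurable (W A))
    (hw : ∀ A, w A =ᵐ[P] W A)
    (huniq : ∀ F : Lp ℝ 2 P, ((0 : Lp ℝ 2 ν), F) ∈ (elementaryGraph P W).topologicalClosure → F = 0)
    {φ : X → ℝ} {F : Lp ℝ 2 P} (hF : IsItoIntegral P W φ F) {ε : ℝ} (hε : 0 < ε) :
    ∃ 𝒜 : CountablePartition ν, ∃ F' ∈ lpMeas ℝ ℝ (cylinderAlgebra W 𝒜) 2 P, ‖F - F'‖ < ε := by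
  obtain ⟨f, -, hF⟩ := hF
  rw [← SetLike.mem_coe, Submodule.topologicalClosure_coe, Metric.mem_closure_iff] at hF
  obtain ⟨⟨g, F'⟩, hg, hdist⟩ := hF ε hε
  have hspan : F' ∈ Submodule.span ℝ (Set.range w) := by
    have h1 : F' ∈ (elementaryGraph P W).map (LinearMap.snd ℝ _ _) := ⟨_, hg, rfl⟩
    rw [elementaryGraph, Submodule.map_span] at h1
    refine Submodule.span_mono ?_ h1
    rintro _ ⟨q, ⟨A, -, hq⟩, rfl⟩
    exact ⟨A, Lp.ext ((hw A).trans hq.symm)⟩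
  obtain ⟨c, rfl⟩ := Finsupp.mem_span_range_iff_exists_finsupp.1 hspan
  obtain ⟨𝒜, h𝒜⟩ := exists_partition_subordinate c.support
  refine ⟨𝒜, c.sum fun A a => a • w A, ?_, lt_of_le_of_lt ?_ hdist⟩
  · exact Submodule.sum_mem _ fun A hA => Submodule.smul_mem _ _
      (mem_lpMeas_of_subset_or_disjoint hW hw huniq 𝒜 (h𝒜 A hA))
  · rw [← dist_eq_norm, Prod.dist_eq]
    exact le_max_right _ _

theorem itoIntegral_spec {φ : X → ℝ} (h : ItoIntegrable P W φ) :
    IsItoIntegral P W φ (itoIntegral P W φ) := by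
  rw [itoIntegral, dif_pos h]
  exact h.choose_spec

end Ito

end GaussianField

/-! ### The monotonicity theorem. -/

open GaussianField in
theorem corollary5p2 {X Ω : Type*} [MeasurableSpace X] [MeasurableSpace Ω]
    (ν : Measure X) [SigmaFinite ν] (P : Measure Ω) [IsProbabilityMeasure P]
    -- the closed operator `S` with core `𝓓_fin`, and the factorization `k_A = S χ_A` of `K`
    (S : Lp ℝ 2 ν →ₗ.[ℝ] Lp ℝ 2 ν) (hS : S.IsClosed) (hcore : S.HasCore (Dfin ν))
    (k : Bfin ν → Lp ℝ 2 ν) (hk : ∀ A, (chi ν A, k A) ∈ S.graph)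
    (K : Bfin ν → Bfin ν → ℝ) (hK : ∀ A B, K A B = ⟪k A, k B⟫_ℝ)
    -- the centered Gaussian process `W` with covariance kernel `K`
    (W : Bfin ν → Ω → ℝ) (hW : ∀ A, Measurable (W A)) (hG : IsGaussianProcess W P)
    (hmean : ∀ A, ∫ ω, W A ω ∂P = 0)
    (hcov : ∀ A B, ∫ ω, W A ω * W B ω ∂P = K A B)
    (φ : X → ℝ) (hφ : Measurable φ) :
    (∀ 𝒜 𝒜' : CountablePartition ν, 𝒜.RefinedBy 𝒜' →
        condSecondMoment P W φ 𝒜 ≤ condSecondMoment P W φ 𝒜') ∧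
      (⨆ 𝒜 : CountablePartition ν, condSecondMoment P W φ 𝒜) = secondMoment P W φ ∧
      ((⨆ 𝒜 : CountablePartition ν, condSecondMoment P W φ 𝒜) < ∞ ↔ InDomain S φ) := by
  have hcov' : ∀ A B, ∫ ω, W A ω * W B ω ∂P = ⟪k A, k B⟫_ℝ := fun A B => by rw [hcov, hK]
  choose w hw using exists_toLp hG
  have huniq : ∀ F : Lp ℝ 2 P,
      ((0 : Lp ℝ 2 ν), F) ∈ (elementaryGraph P W).topologicalClosure → F = 0 := fun F hF =>
    IsItoIntegral.unique (φ := fun _ => 0) hS hk hG hcov' ⟨0, Lp.coeFn_zero _ _ _, hF⟩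
      ⟨0, Lp.coeFn_zero _ _ _, Submodule.zero_mem _⟩
  have hsup : (⨆ 𝒜 : CountablePartition ν, condSecondMoment P W φ 𝒜) = secondMoment P W φ := by
    by_cases hI : ItoIntegrable P W φ
    · simp only [condSecondMoment, secondMoment, if_pos hI]
      set F := itoIntegral P W φ with hFdef
      have hF : IsItoIntegral P W φ F := itoIntegral_spec hI
      rw [lintegral_enorm_sq_eq]
      simp only [fun 𝒜 => lintegral_enorm_condExp_sq_eq (cylinderAlgebra_le hW 𝒜) F]
      rw [← ENNReal.iSup_pow_of_ne_zero two_ne_zero]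
      congr 1
      refine le_antisymm (iSup_le fun 𝒜 => ?_) ?_
      · rw [← ofReal_norm, ← ofReal_norm]
        exact ENNReal.ofReal_le_ofReal (norm_condExpL2_le _ F)
      · refine ENNReal.le_of_forall_pos_le_add fun ε hε _ => ?_
        -- `ε / 2` compensates the factor 2 in `norm_sub_le_norm_condExpL2`.
        obtain ⟨𝒜, F', hF', hlt⟩ := exists_mem_lpMeas_norm_sub_lt hW hw huniq hF
          (ε := ε / 2) (by positivity)
        have h1 := norm_sub_le_norm_condExpL2 (cylinderAlgebra_le hW 𝒜) F hF'
        refine le_trans ?_ (add_le_add_left (le_iSup _ 𝒜) _)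
        rw [← ofReal_norm, ← ofReal_norm, ← ENNReal.ofReal_coe_nnreal,
          ← ENNReal.ofReal_add (norm_nonneg _) ε.coe_nonneg]
        exact ENNReal.ofReal_le_ofReal (by linarith)
    · simp only [condSecondMoment, secondMoment, if_neg hI]
      -- A partition must exist here: the supremum of the constant `∞` over an empty family would be
      -- `0`.
      obtain ⟨𝒜, -⟩ := exists_partition_subordinate (ν := ν) ∅
      have : Nonempty (CountablePartition ν) := ⟨𝒜⟩
      exact iSup_const
  refine ⟨fun 𝒜 𝒜' h => ?_, hsup, ?_⟩
  · by_cases hI : ItoIntegrable P W φ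
    · simp only [condSecondMoment, if_pos hI]
      rw [lintegral_enorm_condExp_sq_eq (cylinderAlgebra_le hW 𝒜),
        lintegral_enorm_condExp_sq_eq (cylinderAlgebra_le hW 𝒜'), ← ofReal_norm, ← ofReal_norm]
      gcongr
      exact norm_condExpL2_le_of_lpMeas_le _ _ (lpMeas_cylinderAlgebra_mono hW hw huniq h) _
    · simp only [condSecondMoment, if_neg hI, le_refl]
  · rw [hsup, ← itoIntegrable_iff_inDomain hS hcore hk hG hcov']
    by_cases hI : ItoIntegrable P W φ
    · simp only [secondMoment, hI, iff_true, lintegral_enorm_sq_eq]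
      exact ENNReal.pow_lt_top enorm_lt_top
    · simp [secondMoment, hI]
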